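/- For a positive integer $t$ let $\mathrm{rad}(t)$ be the largest squarefree divisor of $t$, and put $\mathrm{rad}_4(t)=\mathrm{rad}(t)$ if $4\nmid t$ and $\mathrm{rad}_4(t)=2\,\mathrm{rad}(t)$ if $4\mid t$. For a prime power $q$ let $N_t(q)$ be the number of irreducible binomials of the form $X^t-a\in\mathbb F_q[X]$ with $a\in\mathbb F_q^*$. Write $\log x=\max\{\ln x,2\}$, where $\ln$ is the natural logarithm. For any fixed $\varepsilon>0$, uniformly over real $Q$ and positive integers $t$ with $\mathrm{rad}_4(t)\le Q^{1-\varepsilon}$, we have $$\sum_{\substack{q\le Q\\ q\text{ a prime power}}}N_t(q)\le(1+o(1))\frac{Q^2}{\mathrm{rad}_4(t)\,\log\bigl(Q/\mathrm{rad}_4(t)\bigr)}\qquad\text{as }Q\to\infty.$$ That is, for all $\varepsilon>0$ and $\delta>0$ there is a $Q_0=Q_0(\varepsilon,\delta)$ such that for all real $Q\ge Q_0$ and all positive integers $t$ with $\mathrm{rad}_4(t)\le Q^{1-\varepsilon}$ the sum on the left is at most $(1+\delta)\,Q^2/\bigl(\mathrm{rad}_4(t)\log(Q/\mathrm{rad}_4(t))\bigr)$.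 -/

import Mathlib

open Polynomial

noncomputable section

namespace IrredBinomials

/-- The truncated logarithm `log x = max {ln x, 2}`. -/
def tlog (x : ℝ) : ℝ := max (Real.log x) 2

/-- `rad₄(t)` is the radical of `t` if `4 ∤ t`, and twice the radical of `t` if `4 ∣ t`. -/
def rad4 (t : ℕ) : ℕ :=
  if 4 ∣ t then 2 * UniqueFactorizationMonoid.radical t
  else UniqueFactorizationMonoid.radical t

/-- The finite field with `q` elements, for a prime power `q`
(the base of `q` is its least prime factor `p`, the exponent is the multiplicity of `p`). -/
def Fq (q : ℕ) (hq : IsPrimePow q) : Type :=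
  haveI : Fact q.minFac.Prime := ⟨Nat.minFac_prime hq.ne_one⟩
  GaloisField q.minFac (q.factorization q.minFac)

instance (q : ℕ) (hq : IsPrimePow q) : Field (Fq q hq) :=
  haveI : Fact q.minFac.Prime := ⟨Nat.minFac_prime hq.ne_one⟩
  inferInstanceAs (Field (GaloisField q.minFac (q.factorization q.minFac)))

theorem card_Fq (q : ℕ) (hq : IsPrimePow q) : Nat.card (Fq q hq) = q := by
  have : Fact q.minFac.Prime := ⟨Nat.minFac_prime hq.ne_one⟩
  have h0 : q.factorization q.minFac ≠ 0 := by
    have h := (Nat.minFac_prime hq.ne_one).factorization_pos_of_dvd hq.ne_zero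
      (Nat.minFac_dvd q)
    omega
  exact (GaloisField.card q.minFac _ h0).trans hq.minFac_pow_factorization_eq

/-- The number of irreducible binomials over `F` of the form `X ^ t - a` (with `a ≠ 0`). -/
def binomialCount (F : Type) [Field F] (t : ℕ) : ℕ :=
  {f : F[X] | (∃ a : F, a ≠ 0 ∧ f = X ^ t - C a) ∧ Irreducible f}.ncard

open Classical in
/-- `N_t(q)`, the number of irreducible binomials `X ^ t - a` over the field with `q` elements.
It is meant for prime powers `q` only, and has the value `0` at all other `q`. -/
def N (t q : ℕ) : ℕ :=
  if hq : IsPrimePow q then binomialCount (Fq q hq) t else 0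

end IrredBinomials

end

/-!
Let `r = rad₄ t`. If `X ^ t - a` is irreducible over the field with `q` elements, then `r ∣ q - 1`
and `a` is not a `p`-th power for any prime `p ∣ t`. As the multiplicative group is cyclic, at most
`φ(r) * m` elements `a` qualify when `q = r * m + 1`, so the sum is at most `φ(r) * ∑ m` over the
`m ≤ M = ⌊Q / r⌋` for which `r * m + 1` is a prime power. Powers of primes `p ≤ R` contribute
little. The other prime powers survive the sieve by the primes `p ≤ R` not dividing `r`, and
Selberg's sieve bounds their contribution to `∑ m` by `M * (M + 1) / (2 * S) + 2 * M * R ^ 2`, where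
`φ(r) * log (R + 1) ≤ r * S`. Taking for `R` a power of `Q / r` with exponent slightly below `1 / 2`
makes the second term negligible.
-/

namespace IrredBinomials

section SelbergSieve

open Finset ArithmeticFunction BoundingSieve
open scoped ArithmeticFunction.Moebius

theorem sum_divisors_filter_dvd_moebius {e f : ℕ} (hf : Squarefree f) :
    ∑ d ∈ f.divisors with e ∣ d, (μ d : ℝ) = if e = f then (μ e : ℝ) else 0 := by
  by_cases hef : e ∣ f
  · obtain ⟨k, rfl⟩ := hef
    obtain ⟨he, hk⟩ : e ≠ 0 ∧ k ≠ 0 := mul_ne_zero_iff.1 hf.ne_zero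
    have hcop : e.Coprime k := Nat.coprime_of_squarefree_mul hf
    have hmultiples : (e * k).divisors.filter (e ∣ ·) = k.divisors.image (e * ·) := by
      ext d
      simp only [mem_filter, Nat.mem_divisors, mem_image]
      constructor
      · rintro ⟨⟨hd, -⟩, c, rfl⟩
        exact ⟨c, ⟨Nat.dvd_of_mul_dvd_mul_left he.bot_lt hd, hk⟩, rfl⟩
      · rintro ⟨c, ⟨hc, -⟩, rfl⟩
        exact ⟨⟨Nat.mul_dvd_mul_left e hc, hf.ne_zero⟩, dvd_mul_right _ _⟩
    have hsum : ∑ c ∈ k.divisors, μ c = if k = 1 then 1 else 0 := by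
      rw [← coe_mul_zeta_apply, moebius_mul_coe_zeta, one_apply]
    calc ∑ d ∈ (e * k).divisors with e ∣ d, (μ d : ℝ)
        = ∑ c ∈ k.divisors, (μ (e * c) : ℝ) := by
          rw [hmultiples, sum_image fun a _ b _ h => Nat.eq_of_mul_eq_mul_left he.bot_lt h]
      _ = ∑ c ∈ k.divisors, (μ e * μ c : ℝ) := by
          refine sum_congr rfl fun c hc => ?_
          rw [isMultiplicative_moebius.map_mul_of_coprime
            (hcop.coprime_dvd_right (Nat.dvd_of_mem_divisors hc)), Int.cast_mul]
      _ = μ e * (if k = 1 then 1 else 0) := by rw [← mul_sum]; exact_mod_cast congrArg _ hsum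
      _ = if e = e * k then (μ e : ℝ) else 0 := by simp [he]
  · rw [if_neg (fun h => hef h.dvd), filter_eq_empty_iff.2, sum_empty]
    exact fun d hd h => hef (h.trans (Nat.dvd_of_mem_divisors hd))

variable (s : SelbergSieve)

/-- The support `{l ∣ P : l ≤ √y}` of the Selberg weights, where `P` is the product of the
sifting primes and `y` is the level. -/
noncomputable def selbergSupport : Finset ℕ :=
  {l ∈ s.prodPrimes.divisors | (l : ℝ) ^ 2 ≤ s.level}

/-- Selberg's sum `∑ g(l)` over `l ∣ P`, `l ≤ √y`, whose inverse is the minimum of the main term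
of the `Λ²` sieve. -/
noncomputable def selbergSum : ℝ := ∑ l ∈ selbergSupport s, s.selbergTerms l

/-- The weights `λ_d` of the Selberg sieve, which minimise the main term of the `Λ²` sieve subject
to `λ_1 = 1`. They vanish outside `selbergSupport s`. -/
noncomputable def selbergWeight (d : ℕ) : ℝ :=
  μ d / (s.nu d * selbergSum s) * ∑ l ∈ selbergSupport s with d ∣ l, s.selbergTerms l

variable {s}

theorem mem_selbergSupport {l : ℕ} :
    l ∈ selbergSupport s ↔ l ∣ s.prodPrimes ∧ (l : ℝ) ^ 2 ≤ s.level := by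
  simp [selbergSupport, prodPrimes_ne_zero]

theorem mem_selbergSupport_of_dvd {d l : ℕ} (hl : l ∈ selbergSupport s) (hd : d ∣ l) :
    d ∈ selbergSupport s := by
  rw [mem_selbergSupport] at hl ⊢
  have hdl : d ≤ l := Nat.le_of_dvd (Nat.pos_of_dvd_of_pos hl.1 prodPrimes_ne_zero.bot_lt) hd
  exact ⟨hd.trans hl.1, le_trans (by gcongr) hl.2⟩

theorem selbergTerms_pos_of_mem {l : ℕ} (hl : l ∈ selbergSupport s) : 0 < s.selbergTerms l :=
  selbergTerms_pos (mem_selbergSupport.1 hl).1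

variable (s) in
theorem card_selbergSupport_sq_le : (#(selbergSupport s) : ℝ) ^ 2 ≤ s.level := by
  have hlevel : 0 ≤ s.level := zero_le_one.trans s.one_le_level
  have hsub : selbergSupport s ⊆ Icc 1 ⌊√s.level⌋₊ := fun l hl => by
    rw [mem_selbergSupport] at hl
    exact mem_Icc.2 ⟨Nat.pos_of_dvd_of_pos hl.1 prodPrimes_ne_zero.bot_lt,
      Nat.le_floor (Real.le_sqrt_of_sq_le hl.2)⟩
  have hcard : (#(selbergSupport s) : ℝ) ≤ √s.level := by
    refine le_trans ?_ (Nat.floor_le (Real.sqrt_nonneg _))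
    exact_mod_cast (card_le_card hsub).trans_eq (by simp)
  exact (Real.le_sqrt (Nat.cast_nonneg _) hlevel).1 hcard

variable (s) in
theorem selbergSum_pos : 0 < selbergSum s :=
  sum_pos (fun _ => selbergTerms_pos_of_mem) ⟨1, by simpa [mem_selbergSupport] using s.one_le_level⟩

variable (s) in
theorem selbergWeight_one : selbergWeight s 1 = 1 := by
  have hS := (selbergSum_pos s).ne'
  simp only [selbergWeight, moebius_apply_one, Int.cast_one, s.nu_mult.map_one, one_mul, one_dvd,
    filter_true]
  rw [← selbergSum]
  exact one_div_mul_cancel hS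

theorem selbergWeight_eq_zero {d : ℕ} (hd : d ∉ selbergSupport s) : selbergWeight s d = 0 := by
  rw [selbergWeight, filter_eq_empty_iff.2, sum_empty, mul_zero]
  exact fun l hl hdl => hd (mem_selbergSupport_of_dvd hl hdl)

-- The weights are chosen so that the linear forms diagonalising the main term take these values.
theorem sum_nu_mul_selbergWeight (l : ℕ) :
    (∑ d ∈ s.prodPrimes.divisors, if l ∣ d then s.nu d * selbergWeight s d else 0) =
      if l ∈ selbergSupport s then μ l * s.selbergTerms l / selbergSum s else 0 := by
  calc _ = ∑ d ∈ s.prodPrimes.divisors, ∑ f ∈ selbergSupport s,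
        (if l ∣ d ∧ d ∣ f then (μ d : ℝ) else 0) * (s.selbergTerms f / selbergSum s) := by
        refine sum_congr rfl fun d hd => ?_
        have hν := nu_ne_zero (Nat.dvd_of_mem_divisors hd)
        split_ifs with hld
        · simp only [selbergWeight, hld, true_and, ite_mul, zero_mul, ← sum_filter, ← mul_sum,
            ← sum_div]
          field_simp
        · simp only [hld, false_and, if_false, zero_mul, sum_const_zero]
    _ = ∑ f ∈ selbergSupport s,
        (∑ d ∈ f.divisors with l ∣ d, (μ d : ℝ)) * (s.selbergTerms f / selbergSum s) := by
        rw [sum_comm]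
        refine sum_congr rfl fun f hf => ?_
        rw [← sum_mul, ← sum_filter, ← Nat.divisors_filter_dvd_of_dvd prodPrimes_ne_zero
          (mem_selbergSupport.1 hf).1, filter_filter]
        simp only [and_comm]
    _ = ∑ f ∈ selbergSupport s,
        if l = f then μ f * s.selbergTerms f / selbergSum s else 0 := by
        refine sum_congr rfl fun f hf => ?_
        rw [sum_divisors_filter_dvd_moebius (squarefree_of_dvd_prodPrimes
          (mem_selbergSupport.1 hf).1), ite_mul, zero_mul, mul_div_assoc]
        split_ifs with h <;> simp [h]
    _ = _ := sum_ite_eq _ _ _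

variable (s) in
theorem mainSum_lambdaSquared_selbergWeight :
    s.mainSum (lambdaSquared (selbergWeight s)) = 1 / selbergSum s := by
  have hS := (selbergSum_pos s).ne'
  calc s.mainSum (lambdaSquared (selbergWeight s))
      = ∑ l ∈ s.prodPrimes.divisors,
          if (l : ℝ) ^ 2 ≤ s.level then s.selbergTerms l / selbergSum s ^ 2 else 0 := by
        rw [mainSum_lambdaSquared_eq_sum_mul_sum_sq]
        refine sum_congr rfl fun l hl => ?_
        have hlP := Nat.dvd_of_mem_divisors hl
        have hg := (selbergTerms_pos hlP).ne'
        have hμ : (μ l : ℝ) ^ 2 = 1 := by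
          exact_mod_cast moebius_sq_eq_one_of_squarefree (squarefree_of_dvd_prodPrimes hlP)
        rw [sum_nu_mul_selbergWeight]
        simp only [mem_selbergSupport, hlP, true_and]
        split_ifs
        · rw [div_pow, mul_pow, hμ]
          field_simp
        · simp
    _ = selbergSum s / selbergSum s ^ 2 := by rw [← sum_filter, ← sum_div]; rfl
    _ = 1 / selbergSum s := by field_simp

theorem selbergTerms_div_mul {d k l : ℕ} (hl : l ∣ s.prodPrimes) (hd : d ∣ l) (hk : k ∣ d) :
    s.selbergTerms (l / d * k) * s.selbergTerms d = s.selbergTerms l * s.selbergTerms k := by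
  obtain ⟨m, rfl⟩ := hd
  have hdm : d.Coprime m := Nat.coprime_of_squarefree_mul (squarefree_of_dvd_prodPrimes hl)
  have hd0 : 0 < d := Nat.pos_of_dvd_of_pos ((dvd_mul_right d m).trans hl) prodPrimes_ne_zero.bot_lt
  have hg := s.selbergTerms_isMultiplicative
  rw [Nat.mul_div_cancel_left _ hd0, hg.map_mul_of_coprime hdm,
    hg.map_mul_of_coprime (hdm.symm.coprime_dvd_right hk)]
  ring

theorem gcd_div_mul_of_dvd {d k l : ℕ} (hl : Squarefree l) (hd : d ∣ l) (hk : k ∣ d) :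
    (l / d * k).gcd d = k := by
  obtain ⟨m, rfl⟩ := hd
  have hdm : m.Coprime d := (Nat.coprime_of_squarefree_mul hl).symm
  rw [Nat.mul_div_cancel_left _ (Nat.pos_of_ne_zero (left_ne_zero_of_mul hl.ne_zero)),
    hdm.gcd_mul_left_cancel, Nat.gcd_eq_left hk]

-- Expanding `g(d) / ν(d) = ∑ g(k)` over `k ∣ d`, the left side becomes a sum of `g` over the
-- pairwise distinct elements `(l / d) * k` of the support.
theorem sum_selbergTerms_filter_dvd_le {d : ℕ} (hd : d ∣ s.prodPrimes) :
    ∑ l ∈ selbergSupport s with d ∣ l, s.selbergTerms l ≤ s.nu d * selbergSum s := by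
  have hg := selbergTerms_pos hd
  have hν := nu_pos_of_dvd_prodPrimes hd
  have hinj : Set.InjOn (fun x : ℕ × ℕ => x.1 / d * x.2)
      ({l ∈ selbergSupport s | d ∣ l} ×ˢ d.divisors : Finset (ℕ × ℕ)) := by
    rintro ⟨l, k⟩ hx ⟨l', k'⟩ hx' (heq : l / d * k = l' / d * k')
    simp only [mem_coe, mem_product, mem_filter, mem_selbergSupport, Nat.mem_divisors] at hx hx'
    have hk : k = k' := by
      rw [← gcd_div_mul_of_dvd (squarefree_of_dvd_prodPrimes hx.1.1.1) hx.1.2 hx.2.1, heq,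
        gcd_div_mul_of_dvd (squarefree_of_dvd_prodPrimes hx'.1.1.1) hx'.1.2 hx'.2.1]
    subst hk
    have hk0 : 0 < k := Nat.pos_of_dvd_of_pos hx.2.1 hx.2.2.bot_lt
    rw [(Nat.div_left_inj hx.1.2 hx'.1.2).1 (Nat.eq_of_mul_eq_mul_right hk0 heq)]
  have hexpand : (∑ l ∈ selbergSupport s with d ∣ l, s.selbergTerms l) / s.nu d =
      ∑ x ∈ {l ∈ selbergSupport s | d ∣ l} ×ˢ d.divisors, s.selbergTerms (x.1 / d * x.2) := by
    rw [sum_product, sum_div]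
    refine sum_congr rfl fun l hl => ?_
    rw [mem_filter, mem_selbergSupport] at hl
    have hconv := sum_divisors_selbergTerms_eq_selbergTerms_mul_nu_inv hd
    rw [← sum_filter, Nat.divisors_filter_dvd_of_dvd prodPrimes_ne_zero hd] at hconv
    refine mul_right_cancel₀ hg.ne' ?_
    rw [sum_mul, sum_congr rfl fun k hk => selbergTerms_div_mul hl.1.1 hl.2
      (Nat.dvd_of_mem_divisors hk), ← mul_sum, hconv]
    ring
  rw [← div_le_iff₀' hν, hexpand, ← sum_image (f := fun n => s.selbergTerms n) hinj, selbergSum]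
  refine sum_le_sum_of_subset_of_nonneg (image_subset_iff.2 fun x hx => ?_)
    fun l hl _ => (selbergTerms_pos_of_mem hl).le
  simp only [mem_product, mem_filter, Nat.mem_divisors] at hx
  refine mem_selbergSupport_of_dvd hx.1.1 ?_
  exact (Nat.mul_dvd_mul_left _ hx.2.1).trans (Nat.div_mul_cancel hx.1.2).dvd

theorem abs_selbergWeight_le_one {d : ℕ} (hd : d ∣ s.prodPrimes) : |selbergWeight s d| ≤ 1 := by
  have hpos : 0 < s.nu d * selbergSum s :=
    mul_pos (nu_pos_of_dvd_prodPrimes hd) (selbergSum_pos s)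
  have hμ : |(μ d : ℝ)| ≤ 1 := by exact_mod_cast abs_moebius_le_one
  have hsum : 0 ≤ ∑ l ∈ selbergSupport s with d ∣ l, s.selbergTerms l :=
    sum_nonneg fun l hl => (selbergTerms_pos_of_mem (mem_filter.1 hl).1).le
  rw [selbergWeight, abs_mul, abs_div, abs_of_pos hpos, abs_of_nonneg hsum, div_mul_eq_mul_div,
    div_le_one hpos]
  exact (mul_le_of_le_one_left hsum hμ).trans (sum_selbergTerms_filter_dvd_le hd)

theorem abs_lambdaSquared_le (w : ℕ → ℝ) (d : ℕ) :
    |lambdaSquared w d| ≤ lambdaSquared (fun e => |w e|) d := by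
  refine (abs_sum_le_sum_abs _ _).trans (sum_le_sum fun d₁ _ => ?_)
  refine (abs_sum_le_sum_abs _ _).trans (sum_le_sum fun d₂ _ => ?_)
  split_ifs
  · rw [abs_mul]
  · rw [abs_zero]

theorem sum_divisors_lambdaSquared {n : ℕ} (hn : n ≠ 0) (w : ℕ → ℝ) :
    ∑ d ∈ n.divisors, lambdaSquared w d = (∑ d ∈ n.divisors, w d) ^ 2 := by
  calc ∑ d ∈ n.divisors, lambdaSquared w d
      = ∑ d ∈ n.divisors, ∑ d₁ ∈ n.divisors, ∑ d₂ ∈ n.divisors,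
          if d = d₁.lcm d₂ then w d₁ * w d₂ else 0 := by
        refine sum_congr rfl fun d hd => ?_
        simp only [lambdaSquared, ← Nat.divisors_filter_dvd_of_dvd hn (Nat.dvd_of_mem_divisors hd),
          sum_filter, ite_sum_zero, ← ite_and]
        congr! 5 with d₁ _ d₂ _
        constructor
        · exact fun h => h.2.2
        · rintro rfl
          exact ⟨Nat.dvd_lcm_left _ _, Nat.dvd_lcm_right _ _, rfl⟩
    _ = ∑ d₁ ∈ n.divisors, ∑ d₂ ∈ n.divisors, w d₁ * w d₂ := by
        rw [sum_comm]
        refine sum_congr rfl fun d₁ h₁ => ?_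
        rw [sum_comm]
        refine sum_congr rfl fun d₂ h₂ => ?_
        rw [sum_ite_eq_of_mem']
        exact Nat.mem_divisors.2 ⟨Nat.lcm_dvd (Nat.dvd_of_mem_divisors h₁)
          (Nat.dvd_of_mem_divisors h₂), hn⟩
    _ = (∑ d ∈ n.divisors, w d) ^ 2 := by rw [sq, sum_mul_sum]

variable (s) in
theorem sum_abs_selbergWeight_sq_le :
    (∑ d ∈ s.prodPrimes.divisors, |selbergWeight s d|) ^ 2 ≤ s.level := by
  have hcard : ∑ d ∈ s.prodPrimes.divisors, |selbergWeight s d| ≤ #(selbergSupport s) := by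
    calc ∑ d ∈ s.prodPrimes.divisors, |selbergWeight s d|
        = ∑ d ∈ selbergSupport s, |selbergWeight s d| := by
          refine (sum_subset (filter_subset _ _) fun d _ hd => ?_).symm
          rw [selbergWeight_eq_zero hd, abs_zero]
      _ ≤ ∑ d ∈ selbergSupport s, 1 :=
          sum_le_sum fun d hd => abs_selbergWeight_le_one (mem_selbergSupport.1 hd).1
      _ = #(selbergSupport s) := by simp
  exact (pow_le_pow_left₀ (by positivity) hcard 2).trans (card_selbergSupport_sq_le s)

theorem siftedSum_le_div_selbergSum_add {B : ℝ}
    (hB : ∀ d, d ∣ s.prodPrimes → |s.rem d| ≤ B) :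
    s.siftedSum ≤ s.totalMass / selbergSum s + s.level * B := by
  have hB0 : 0 ≤ B := (abs_nonneg _).trans (hB 1 (one_dvd _))
  have herr : s.errSum (lambdaSquared (selbergWeight s)) ≤ s.level * B := by
    calc s.errSum (lambdaSquared (selbergWeight s))
        ≤ ∑ d ∈ s.prodPrimes.divisors, lambdaSquared (fun e => |selbergWeight s e|) d * B := by
          refine sum_le_sum fun d hd => ?_
          exact mul_le_mul (abs_lambdaSquared_le _ d) (hB d (Nat.dvd_of_mem_divisors hd))
            (abs_nonneg _) ((abs_nonneg _).trans (abs_lambdaSquared_le _ d))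
      _ = (∑ d ∈ s.prodPrimes.divisors, |selbergWeight s d|) ^ 2 * B := by
          rw [← sum_mul, sum_divisors_lambdaSquared prodPrimes_ne_zero]
      _ ≤ s.level * B := by gcongr; exact sum_abs_selbergWeight_sq_le s
  have h := siftedSum_le_mainSum_errSum_of_upperMoebius (s := s.toBoundingSieve) _
    (upperMoebius_lambdaSquared _ (selbergWeight_one s))
  rw [mainSum_lambdaSquared_selbergWeight, mul_one_div] at h
  linarith

end SelbergSieve
section Progression

open Finset ArithmeticFunction

theorem abs_count_modEq_sub_div_le_one {d : ℕ} (hd : 0 < d) (c n : ℕ) :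
    |(Nat.count (· ≡ c [MOD d]) n : ℝ) - n / d| ≤ 1 := by
  have hd' : (0 : ℚ) < d := by exact_mod_cast hd
  have hlt : ((c % d : ℕ) : ℚ) < d := by exact_mod_cast Nat.mod_lt c hd
  have hpos : (0 : ℚ) ≤ (c % d : ℕ) / d := by positivity
  have hcd : ((c % d : ℕ) : ℚ) / d < 1 := (div_lt_one hd').2 hlt
  have hceil : (Nat.count (· ≡ c [MOD d]) n : ℤ) = ⌈((n : ℚ) - (c % d : ℕ)) / d⌉ :=
    Nat.count_modEq_card_eq_ceil n hd c
  obtain ⟨hlow, hhigh⟩ := Int.ceil_eq_iff.1 hceil.symm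
  rw [sub_div, Int.cast_natCast] at hlow hhigh
  have habs : |(Nat.count (· ≡ c [MOD d]) n : ℚ) - n / d| ≤ 1 :=
    abs_le.2 ⟨by linarith, by linarith⟩
  rw [← Rat.cast_le (K := ℝ)] at habs
  push_cast at habs
  exact habs

theorem sum_range_filter_eq_count (P : ℕ → Prop) [DecidablePred P] (M : ℕ) :
    ∑ m ∈ range (M + 1) with P m, (m : ℝ) =
      M * Nat.count P (M + 1) - ∑ k ∈ range M, (Nat.count P (k + 1) : ℝ) := by
  rw [sum_filter]
  induction M with
  | zero => simp
  | succ M ih =>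
    rw [sum_range_succ, ih, sum_range_succ _ M, Nat.count_succ P (M + 1)]
    split_ifs <;> push_cast <;> ring

theorem abs_sum_range_filter_modEq_sub_le {d : ℕ} (hd : 0 < d) (c M : ℕ) :
    |∑ m ∈ range (M + 1) with m ≡ c [MOD d], (m : ℝ) - (d : ℝ)⁻¹ * (M * (M + 1) / 2)| ≤
      2 * M := by
  let e (n : ℕ) : ℝ := Nat.count (· ≡ c [MOD d]) n - n / d
  have he (n : ℕ) : |e n| ≤ 1 := abs_count_modEq_sub_div_le_one hd c n
  have hgauss : ∑ k ∈ range M, ((k + 1 : ℕ) : ℝ) = M * (M + 1) / 2 := by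
    induction M with
    | zero => simp
    | succ M ih => rw [sum_range_succ, ih]; push_cast; ring
  have hsum : ∑ m ∈ range (M + 1) with m ≡ c [MOD d], (m : ℝ) - (d : ℝ)⁻¹ * (M * (M + 1) / 2) =
      M * e (M + 1) - ∑ k ∈ range M, e (k + 1) := by
    rw [sum_range_filter_eq_count, sum_sub_distrib, ← sum_div, hgauss]
    push_cast [e]
    ring
  have hlast : |M * e (M + 1)| ≤ M := by
    rw [abs_mul, Nat.abs_cast]
    exact mul_le_of_le_one_right (Nat.cast_nonneg _) (he _)
  have hrest : |∑ k ∈ range M, e (k + 1)| ≤ M :=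
    (abs_sum_le_sum_abs _ _).trans ((sum_le_sum fun k _ => he _).trans (by simp))
  rw [hsum]
  linarith [abs_sub (M * e (M + 1)) (∑ k ∈ range M, e (k + 1))]

theorem exists_dvd_mul_add_one_iff_modEq {r d : ℕ} (hd : 0 < d) (h : d.Coprime r) :
    ∃ c, ∀ m, d ∣ r * m + 1 ↔ m ≡ c [MOD d] := by
  have : NeZero d := ⟨hd.ne'⟩
  refine ⟨(-(r : ZMod d)⁻¹).val, fun m => ?_⟩
  have hinv : (r : ZMod d) * (r : ZMod d)⁻¹ = 1 := ZMod.coe_mul_inv_eq_one r h.symm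
  rw [← ZMod.natCast_eq_natCast_iff, ← ZMod.natCast_eq_zero_iff, ZMod.natCast_zmod_val]
  push_cast
  constructor
  · intro hm
    linear_combination (r : ZMod d)⁻¹ * hm - (m : ZMod d) * hinv
  · intro hm
    linear_combination (r : ZMod d) * hm - hinv

theorem abs_sum_range_filter_dvd_sub_le {r d : ℕ} (hd : 0 < d) (h : d.Coprime r) (M : ℕ) :
    |∑ m ∈ range (M + 1) with d ∣ r * m + 1, (m : ℝ) - (d : ℝ)⁻¹ * (M * (M + 1) / 2)| ≤
      2 * M := by
  obtain ⟨c, hc⟩ := exists_dvd_mul_add_one_iff_modEq hd h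
  simp_rw [hc]
  exact abs_sum_range_filter_modEq_sub_le hd c M

/-- The Selberg sieve for the integers `n = r * m + 1` with `m ≤ M`, weighted by `m`, by the primes
`p ≤ R` not dividing `r`. The weight counts, up to the factor `φ(r)`, the candidates `a` for which
`X ^ t - a` may be irreducible over the field with `n` elements when `r = rad₄ t`. -/
noncomputable def progressionSieve (r M R : ℕ) (hR : 1 ≤ R) : SelbergSieve where
  support := (range (M + 1)).image (r * · + 1)
  prodPrimes := ∏ p ∈ Nat.primesLE R with ¬p ∣ r, p
  prodPrimes_squarefree := (squarefree_primorial R).squarefree_of_dvd <| by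
    rw [primorial_eq_prod_primesLE]
    exact prod_dvd_prod_of_subset _ _ _ (filter_subset _ _)
  weights n := ((n - 1) / r : ℕ)
  weights_nonneg _ := Nat.cast_nonneg _
  totalMass := M * (M + 1) / 2
  nu := ⟨fun n => (n : ℝ)⁻¹, by simp⟩
  nu_mult := ⟨by simp, by simp [mul_comm]⟩
  nu_pos_of_prime p hp _ := by
    have := hp.pos
    simpa
  nu_lt_one_of_prime p hp _ := inv_lt_one_of_one_lt₀ (by exact_mod_cast hp.one_lt)
  level := R ^ 2
  one_le_level := one_le_pow₀ (by exact_mod_cast hR)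

variable {r M R : ℕ} {hR : 1 ≤ R}

theorem prodPrimes_progressionSieve :
    (progressionSieve r M R hR).prodPrimes = ∏ p ∈ Nat.primesLE R with ¬p ∣ r, p :=
  rfl

theorem coprime_of_dvd_prodPrimes_progressionSieve {d : ℕ}
    (hd : d ∣ (progressionSieve r M R hR).prodPrimes) : d.Coprime r := by
  rw [prodPrimes_progressionSieve] at hd
  refine Nat.Coprime.coprime_dvd_left hd (Nat.Coprime.prod_left fun p hp => ?_)
  rw [mem_filter] at hp
  exact (Nat.prime_of_mem_primesLE hp.1).coprime_iff_not_dvd.2 hp.2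

theorem abs_rem_progressionSieve_le {d : ℕ} (hr : 0 < r)
    (hd : d ∣ (progressionSieve r M R hR).prodPrimes) :
    |(progressionSieve r M R hR).rem d| ≤ 2 * M := by
  have hd0 : 0 < d := Nat.pos_of_dvd_of_pos hd BoundingSieve.prodPrimes_ne_zero.bot_lt
  have hmult : (progressionSieve r M R hR).multSum d =
      ∑ m ∈ range (M + 1) with d ∣ r * m + 1, (m : ℝ) := by
    simp only [BoundingSieve.multSum, progressionSieve]
    rw [sum_image fun a _ b _ h => Nat.eq_of_mul_eq_mul_left hr (Nat.add_right_cancel h)]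
    simp only [Nat.add_sub_cancel, Nat.mul_div_cancel_left _ hr, sum_filter]
  rw [BoundingSieve.rem, hmult]
  exact abs_sum_range_filter_dvd_sub_le hd0 (coprime_of_dvd_prodPrimes_progressionSieve hd) M

theorem totient_inv_eq_inv_mul_prod (n : ℕ) :
    (n.totient : ℝ)⁻¹ = (n : ℝ)⁻¹ * ∏ p ∈ n.primeFactors, (1 - (p : ℝ)⁻¹)⁻¹ := by
  have h : (n.totient : ℝ) = n * ∏ p ∈ n.primeFactors, (1 - (p : ℝ)⁻¹) := by
    have hq := congrArg (Rat.cast : ℚ → ℝ) (Nat.totient_eq_mul_prod_factors n)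
    push_cast at hq
    exact hq
  rw [h, mul_inv, prod_inv_distrib]

theorem selbergTerms_progressionSieve (d : ℕ) :
    (progressionSieve r M R hR).selbergTerms d = (d.totient : ℝ)⁻¹ := by
  rw [BoundingSieve.selbergTerms_apply, totient_inv_eq_inv_mul_prod]
  rfl

theorem sum_inv_le_div_totient {n : ℕ} (hn : n ≠ 0) {s : Finset ℕ}
    (hs : ∀ m ∈ s, m ∈ Nat.factoredNumbers n.primeFactors) :
    ∑ m ∈ s, (m : ℝ)⁻¹ ≤ n / n.totient := by
  classical
  let f : ℕ →* ℝ := (invMonoidWithZeroHom : ℝ →*₀ ℝ).toMonoidHom.comp (Nat.castRingHom ℝ)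
  have hf : ∀ {p : ℕ}, p.Prime → ‖f p‖ < 1 := fun {p} hp => by
    change ‖(p : ℝ)⁻¹‖ < 1
    rw [norm_inv, RCLike.norm_natCast]
    exact inv_lt_one_of_one_lt₀ (by exact_mod_cast hp.one_lt)
  have heuler := (EulerProduct.summable_and_hasSum_factoredNumbers_prod_filter_prime_geometric hf
    n.primeFactors).2
  have hprod : ∏ p ∈ n.primeFactors with p.Prime, (1 - f p)⁻¹ = (n : ℝ) / n.totient := by
    have hn' : (n : ℝ) ≠ 0 := by exact_mod_cast hn
    rw [filter_true_of_mem fun p => Nat.prime_of_mem_primeFactors, div_eq_mul_inv,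
      totient_inv_eq_inv_mul_prod, mul_inv_cancel_left₀ hn']
    rfl
  rw [hprod] at heuler
  have hle := sum_le_hasSum (s.subtype (· ∈ Nat.factoredNumbers n.primeFactors))
    (fun m _ => inv_nonneg.2 (Nat.cast_nonneg (m : ℕ))) heuler
  rwa [sum_subtype_of_mem (fun m => f m) hs] at hle

theorem sum_inv_le_inv_mul_div_totient {d n : ℕ} (hd : d ≠ 0) (hn : n ≠ 0) {s : Finset ℕ}
    (hdvd : ∀ m ∈ s, d ∣ m) (hs : ∀ m ∈ s, m ∈ Nat.factoredNumbers n.primeFactors) :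
    ∑ m ∈ s, (m : ℝ)⁻¹ ≤ (d : ℝ)⁻¹ * (n / n.totient) := by
  have hinj : Set.InjOn (· / d) (s : Set ℕ) :=
    fun a ha b hb h => (Nat.div_left_inj (hdvd a ha) (hdvd b hb)).1 h
  calc ∑ m ∈ s, (m : ℝ)⁻¹ = (d : ℝ)⁻¹ * ∑ m ∈ s, ((m / d : ℕ) : ℝ)⁻¹ := by
        rw [mul_sum]
        refine sum_congr rfl fun m hm => ?_
        rw [← mul_inv, ← Nat.cast_mul, Nat.mul_div_cancel' (hdvd m hm)]
    _ = (d : ℝ)⁻¹ * ∑ k ∈ s.image (· / d), (k : ℝ)⁻¹ := by rw [sum_image hinj]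
    _ ≤ (d : ℝ)⁻¹ * (n / n.totient) := by
        gcongr
        refine sum_inv_le_div_totient hn fun k hk => ?_
        obtain ⟨m, hm, rfl⟩ := mem_image.1 hk
        exact Nat.mem_factoredNumbers_of_dvd (hs m hm) (Nat.div_dvd_of_dvd (hdvd m hm))

/-- The product of the primes that divide `n` but not `r`. Sorting the integers `n ≤ R` by this
value bounds the Selberg sum of `progressionSieve` from below. -/
def primePart (r n : ℕ) : ℕ := ∏ p ∈ n.primeFactors with ¬p ∣ r, p

theorem primePart_dvd (r n : ℕ) : primePart r n ∣ n :=
  (prod_dvd_prod_of_subset _ _ _ (filter_subset _ _)).trans (Nat.prod_primeFactors_dvd n)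

theorem primePart_mem_selbergSupport {n : ℕ} (hn : n ∈ Icc 1 R) :
    primePart r n ∈ selbergSupport (progressionSieve r M R hR) := by
  rw [mem_Icc] at hn
  have hle : primePart r n ≤ R := (Nat.le_of_dvd hn.1 (primePart_dvd r n)).trans hn.2
  refine mem_selbergSupport.2 ⟨?_, ?_⟩
  · rw [prodPrimes_progressionSieve]
    refine prod_dvd_prod_of_subset _ _ _ ?_
    refine filter_subset_filter _ fun p hp => ?_
    exact Nat.mem_primesLE.2 ⟨(Nat.le_of_mem_primeFactors hp).trans hn.2,
      Nat.prime_of_mem_primeFactors hp⟩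
  · change (primePart r n : ℝ) ^ 2 ≤ (R : ℝ) ^ 2
    gcongr

theorem mem_factoredNumbers_primePart_mul {n : ℕ} (hr : r ≠ 0) (hn : n ≠ 0) :
    n ∈ Nat.factoredNumbers (primePart r n * r).primeFactors := by
  have hpart : primePart r n ≠ 0 := ne_zero_of_dvd_ne_zero hn (primePart_dvd r n)
  refine Nat.mem_factoredNumbers_of_primeFactors_subset hn fun p hp => ?_
  refine Nat.mem_primeFactors.2 ⟨Nat.prime_of_mem_primeFactors hp, ?_, mul_ne_zero hpart hr⟩
  by_cases hpr : p ∣ r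
  · exact hpr.mul_left _
  · exact (dvd_prod_of_mem _ (mem_filter.2 ⟨hp, hpr⟩)).mul_right _

theorem log_le_div_totient_mul_selbergSum (hr : 0 < r) :
    Real.log (R + 1) ≤ r / r.totient * selbergSum (progressionSieve r M R hR) := by
  set s := progressionSieve r M R hR
  calc Real.log (R + 1) ≤ ∑ n ∈ Icc 1 R, (n : ℝ)⁻¹ := by
        have h := log_add_one_le_harmonic R
        rw [harmonic_eq_sum_Icc] at h
        push_cast at h
        exact h
    _ = ∑ d ∈ selbergSupport s, ∑ n ∈ Icc 1 R with primePart r n = d, (n : ℝ)⁻¹ :=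
        (sum_fiberwise_of_maps_to (fun _ => primePart_mem_selbergSupport) _).symm
    _ ≤ ∑ d ∈ selbergSupport s, (d : ℝ)⁻¹ * ((d * r : ℕ) / (d * r).totient) := by
        refine sum_le_sum fun d hd => ?_
        have hd0 : d ≠ 0 :=
          ne_zero_of_dvd_ne_zero BoundingSieve.prodPrimes_ne_zero (mem_selbergSupport.1 hd).1
        refine sum_inv_le_inv_mul_div_totient hd0 (mul_ne_zero hd0 hr.ne') ?_ ?_ <;>
          simp only [mem_filter, mem_Icc] <;> rintro n ⟨⟨hn, -⟩, rfl⟩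
        · exact primePart_dvd r n
        · exact mem_factoredNumbers_primePart_mul hr.ne' (by omega)
    _ = ∑ d ∈ selbergSupport s, r / r.totient * s.selbergTerms d := by
        refine sum_congr rfl fun d hd => ?_
        have hdP := (mem_selbergSupport.1 hd).1
        have hd0 : (d : ℝ) ≠ 0 := by
          exact_mod_cast ne_zero_of_dvd_ne_zero BoundingSieve.prodPrimes_ne_zero hdP
        rw [selbergTerms_progressionSieve,
          Nat.totient_mul (coprime_of_dvd_prodPrimes_progressionSieve hdP)]
        push_cast
        field_simp
    _ = r / r.totient * selbergSum s := by rw [selbergSum, mul_sum]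

theorem totient_mul_siftedSum_progressionSieve_le (hr : 0 < r) :
    r.totient * (progressionSieve r M R hR).siftedSum ≤
      r * (M * (M + 1) / 2 / Real.log (R + 1) + 2 * M * R ^ 2) := by
  set s := progressionSieve r M R hR
  have hS := selbergSum_pos s
  have hlog : 0 < Real.log (R + 1) :=
    Real.log_pos (lt_add_of_pos_left 1 (by exact_mod_cast hR))
  have hφ : (0 : ℝ) < r.totient := by exact_mod_cast Nat.totient_pos.2 hr
  have hφr : (r.totient : ℝ) ≤ r := by exact_mod_cast Nat.totient_le r
  have hmain : r.totient / selbergSum s ≤ r / Real.log (R + 1) := by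
    have h := log_le_div_totient_mul_selbergSum (M := M) (hR := hR) hr
    rw [div_mul_eq_mul_div, le_div_iff₀ hφ] at h
    rw [div_le_div_iff₀ hS hlog]
    linarith
  calc r.totient * s.siftedSum
      ≤ r.totient * (M * (M + 1) / 2 / selbergSum s + R ^ 2 * (2 * M)) := by
        gcongr
        exact siftedSum_le_div_selbergSum_add fun d => abs_rem_progressionSieve_le hr
    _ = M * (M + 1) / 2 * (r.totient / selbergSum s) + r.totient * (2 * M * R ^ 2) := by ring
    _ ≤ M * (M + 1) / 2 * (r / Real.log (R + 1)) + r * (2 * M * R ^ 2) := by gcongr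
    _ = r * (M * (M + 1) / 2 / Real.log (R + 1) + 2 * M * R ^ 2) := by ring

end Progression

section FiniteFields

open Finset UniqueFactorizationMonoid

variable {F : Type*} [Field F]

theorem prime_dvd_card_sub_one_of_irreducible [Finite F] {t ℓ : ℕ} {a : F} (ha : a ≠ 0)
    (h : Irreducible (X ^ t - C a)) (hℓ : ℓ.Prime) (hℓt : ℓ ∣ t) : ℓ ∣ Nat.card F - 1 := by
  by_contra hnd
  have hcop : (Nat.card Fˣ).Coprime ℓ := by
    rw [Nat.card_units]
    exact (hℓ.coprime_iff_not_dvd.2 hnd).symm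
  obtain ⟨b, hb⟩ := (powCoprime hcop).surjective (Units.mk0 a ha)
  exact pow_ne_of_irreducible_X_pow_sub_C h hℓt hℓ.ne_one (b : F) congr(($hb : F))

theorem not_irreducible_X_pow_add_four_mul {s : ℕ} (hs : s ≠ 0) (b : F) :
    ¬Irreducible (X ^ (4 * s) - C (-(4 * b ^ 4))) := by
  intro h
  let f (c : F) : F[X] := C 1 * X ^ 2 + C c * X + C (2 * b ^ 2)
  have sophie_germain : X ^ 4 - C (-(4 * b ^ 4)) = f (2 * b) * f (-(2 * b)) := by
    simp only [f, C_mul, C_neg, C_pow, C_1, map_ofNat]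
    ring
  have hfac : X ^ (4 * s) - C (-(4 * b ^ 4)) =
      expand F s (f (2 * b)) * expand F s (f (-(2 * b))) := by
    rw [← map_mul, ← sophie_germain, map_sub, map_pow, expand_X, expand_C, ← pow_mul, mul_comm]
  have hdeg (c : F) : ¬IsUnit (expand F s (f c)) := by
    intro hu
    have hzero := natDegree_eq_zero_of_isUnit hu
    rw [natDegree_expand, natDegree_quadratic one_ne_zero] at hzero
    omega
  exact (h.isUnit_or_isUnit hfac).elim (hdeg _) (hdeg _)

theorem isSquare_neg_of_not_isSquare [Finite F] (hF : ¬IsSquare (-1 : F)) {a : F}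
    (ha : ¬IsSquare a) : IsSquare (-a) := by
  classical
  have := Fintype.ofFinite F
  have ha0 : -a ≠ 0 := neg_ne_zero.2 fun h => ha (h ▸ IsSquare.zero)
  rw [← quadraticChar_one_iff_isSquare ha0, ← neg_one_mul, map_mul,
    quadraticChar_neg_one_iff_not_isSquare.2 hF, quadraticChar_neg_one_iff_not_isSquare.2 ha]
  norm_num

theorem exists_eq_neg_four_mul_pow_four [Finite F] (hF : ¬IsSquare (-1 : F)) {a : F}
    (ha : ¬IsSquare a) : ∃ b, a = -(4 * b ^ 4) := by
  have htwo : (2 : F) ≠ 0 := fun h => hF ⟨1, by linear_combination -h⟩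
  obtain ⟨c, hc⟩ := isSquare_neg_of_not_isSquare hF ha
  have hc' : a = -(4 * (c / 2) ^ 2) := by
    rw [div_pow, sq, sq, ← hc]
    field_simp
    ring
  obtain ⟨e, he, hsq⟩ : ∃ e, a = -(4 * e ^ 2) ∧ IsSquare e := by
    by_cases h : IsSquare (c / 2)
    · exact ⟨c / 2, hc', h⟩
    · exact ⟨-(c / 2), by rwa [neg_sq], isSquare_neg_of_not_isSquare hF h⟩
  obtain ⟨b, rfl⟩ := hsq
  exact ⟨b, by rw [he]; ring⟩

theorem four_dvd_card_sub_one_of_irreducible [Finite F] {t : ℕ} {a : F} (ha : a ≠ 0)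
    (h : Irreducible (X ^ t - C a)) (ht : 4 ∣ t) : 4 ∣ Nat.card F - 1 := by
  have := Fintype.ofFinite F
  have h2t : 2 ∣ t := dvd_trans (by norm_num) ht
  have h2q : 2 ∣ Nat.card F - 1 := prime_dvd_card_sub_one_of_irreducible ha h Nat.prime_two h2t
  have hcard : 1 < Nat.card F := Finite.one_lt_card
  by_contra h4
  have hneg : ¬IsSquare (-1 : F) := by
    rw [FiniteField.isSquare_neg_one_iff, ← Nat.card_eq_fintype_card]
    omega
  have hsq : ¬IsSquare a := by
    rintro ⟨b, hb⟩
    exact pow_ne_of_irreducible_X_pow_sub_C h h2t (by norm_num) b (by rw [hb, sq])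
  obtain ⟨b, rfl⟩ := exists_eq_neg_four_mul_pow_four hneg hsq
  have ht0 : t ≠ 0 := ne_zero_of_irreducible_X_pow_sub_C h
  obtain ⟨s, rfl⟩ := ht
  exact not_irreducible_X_pow_add_four_mul (right_ne_zero_of_mul ht0) b h

theorem rad4_pos (t : ℕ) : 0 < rad4 t := by
  have := Nat.radical_pos t
  unfold rad4
  split_ifs <;> omega

theorem rad4_dvd {t n : ℕ} (ht : t ≠ 0) (hn : n ≠ 0) (hprime : ∀ p, p.Prime → p ∣ t → p ∣ n)
    (hfour : 4 ∣ t → 4 ∣ n) : rad4 t ∣ n := by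
  have hrad : radical t ∣ n := by
    rw [Nat.radical_dvd_iff hn]
    intro p hp
    rw [Nat.mem_primeFactors] at hp ⊢
    exact ⟨hp.1, hprime p hp.1 hp.2.1, hn⟩
  unfold rad4
  split_ifs with h4
  · obtain ⟨k, hk⟩ : 2 ∣ radical t :=
      (dvd_radical_iff_of_irreducible Nat.prime_two ht).2 (dvd_trans (by norm_num) h4)
    have hcop : Nat.Coprime (2 ^ 2) k :=
      (Nat.coprime_of_squarefree_mul (hk ▸ squarefree_radical)).pow_left 2
    rw [hk, ← mul_assoc]
    exact hcop.mul_dvd_of_dvd_of_dvd (hfour h4) ((Dvd.intro_left 2 hk.symm).trans hrad)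
  · exact hrad

theorem dvd_of_prime_of_dvd_rad4 {t p : ℕ} (hp : p.Prime) (h : p ∣ rad4 t) : p ∣ t := by
  unfold rad4 at h
  split_ifs at h with h4
  · rcases hp.dvd_mul.1 h with h2 | hrad
    · exact h2.trans (dvd_trans (by norm_num) h4)
    · exact hrad.trans radical_dvd_self
  · exact h.trans radical_dvd_self

theorem rad4_dvd_card_sub_one_of_irreducible [Finite F] {t : ℕ} {a : F} (ha : a ≠ 0)
    (h : Irreducible (X ^ t - C a)) : rad4 t ∣ Nat.card F - 1 :=
  rad4_dvd (ne_zero_of_irreducible_X_pow_sub_C h)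
    (Nat.sub_pos_of_lt Finite.one_lt_card).ne'
    (fun _ => prime_dvd_card_sub_one_of_irreducible ha h)
    (four_dvd_card_sub_one_of_irreducible ha h)

theorem count_coprime_mul (s k : ℕ) : Nat.count s.Coprime (s * k) = s.totient * k := by
  induction k with
  | zero => simp
  | succ k ih =>
    have hperiod : Nat.count (fun j => s.Coprime (s * k + j)) s = s.totient := by
      simp only [Nat.coprime_mul_left_add_right, Nat.totient_eq_card_coprime,
        Nat.count_eq_card_filter_range]
    rw [mul_add_one, Nat.count_add, ih, hperiod, mul_add_one]

theorem binomialCount_le {F : Type} [Field F] [Finite F] {t s k : ℕ}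
    (hs : ∀ p, p.Prime → p ∣ s → p ∣ t) (hk : Nat.card F - 1 = s * k) :
    binomialCount F t ≤ s.totient * k := by
  obtain ⟨g, hg⟩ := IsCyclic.exists_generator (α := Fˣ)
  have hexp (u : Fˣ) : ∃ i < s * k, g ^ i = u := by
    obtain ⟨n, rfl⟩ := mem_powers_iff_mem_zpowers.2 (hg u)
    refine ⟨n % Nat.card Fˣ, ?_, pow_mod_natCard g n⟩
    rw [← hk, ← Nat.card_units]
    exact Nat.mod_lt _ Nat.card_pos
  rw [← count_coprime_mul, Nat.count_eq_card_filter_range, ← Set.ncard_coe_finset, binomialCount]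
  refine (Set.ncard_le_ncard ?_ (Set.toFinite _)).trans
    (Set.ncard_image_le (f := fun i : ℕ => (X ^ t - C ((g ^ i : Fˣ) : F) : F[X]))
      (Finset.finite_toSet _))
  rintro f ⟨⟨a, ha, rfl⟩, hirr⟩
  obtain ⟨i, hi, hia⟩ := hexp (Units.mk0 a ha)
  refine ⟨i, ?_, by simp only [hia, Units.val_mk0]⟩
  refine mem_filter.2 ⟨mem_range.2 hi, Nat.coprime_of_dvd fun p hp hps => ?_⟩
  rintro ⟨j, rfl⟩
  rw [mul_comm, pow_mul] at hia
  exact pow_ne_of_irreducible_X_pow_sub_C hirr (hs p hp hps) hp.ne_one ((g ^ j : Fˣ) : F)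
    congr(($hia : F))

instance (q : ℕ) (hq : IsPrimePow q) : Finite (Fq q hq) :=
  Nat.finite_of_card_ne_zero (by rw [card_Fq]; exact hq.ne_zero)

theorem N_eq_zero {t q : ℕ} (h : ¬rad4 t ∣ q - 1) : N t q = 0 := by
  unfold N
  split_ifs with hq
  · refine (congrArg Set.ncard (Set.eq_empty_iff_forall_notMem.2 ?_)).trans (Set.ncard_empty _)
    rintro f ⟨⟨a, ha, rfl⟩, hirr⟩
    have hdvd := rad4_dvd_card_sub_one_of_irreducible ha hirr
    rw [card_Fq] at hdvd
    exact h hdvd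
  · rfl

theorem N_le {t q : ℕ} (h : rad4 t ∣ q - 1) :
    N t q ≤ (rad4 t).totient * ((q - 1) / rad4 t) := by
  unfold N
  split_ifs with hq
  · refine binomialCount_le (fun p => dvd_of_prime_of_dvd_rad4) ?_
    rw [card_Fq, Nat.mul_div_cancel' h]
  · exact Nat.zero_le _

end FiniteFields

section PrimePowers

open Filter Finset Topology

theorem card_filter_isPrimePow_minFac_le (x R : ℕ) :
    #{q ∈ Icc 1 x | IsPrimePow q ∧ q.minFac ≤ R} ≤ R * Nat.log 2 x := by
  calc #{q ∈ Icc 1 x | IsPrimePow q ∧ q.minFac ≤ R}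
      ≤ #((Icc 1 R ×ˢ Icc 1 (Nat.log 2 x)).image fun a => a.1 ^ a.2) := by
        refine card_le_card fun q hq => ?_
        obtain ⟨hqx, hpow, hR⟩ := mem_filter.1 hq
        have hp := Nat.minFac_prime hpow.ne_one
        have hfac := hpow.minFac_pow_factorization_eq
        have hk : 0 < q.factorization q.minFac :=
          hp.factorization_pos_of_dvd hpow.ne_zero q.minFac_dvd
        have hlog : q.factorization q.minFac ≤ Nat.log 2 x :=
          Nat.le_log_of_pow_le one_lt_two <|
            (Nat.pow_le_pow_left hp.two_le _).trans (hfac.trans_le (mem_Icc.1 hqx).2)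
        exact mem_image.2 ⟨(q.minFac, q.factorization q.minFac), mem_product.2
          ⟨mem_Icc.2 ⟨hp.pos, hR⟩, mem_Icc.2 ⟨hk, hlog⟩⟩, hfac⟩
    _ ≤ R * Nat.log 2 x := card_image_le.trans_eq (by simp)

theorem mem_support_progressionSieve {r R x q : ℕ} {hR : 1 ≤ R} (hq : q ∈ Icc 1 x)
    (hr : r ∣ q - 1) : q ∈ (progressionSieve r (x / r) R hR).support := by
  rw [mem_Icc] at hq
  refine mem_image.2 ⟨(q - 1) / r, mem_range.2 ?_, ?_⟩
  · exact Nat.lt_succ_of_le (Nat.div_le_div_right (by omega))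
  · rw [Nat.mul_div_cancel' hr, Nat.sub_add_cancel hq.1]

theorem coprime_prodPrimes_progressionSieve {r M R n : ℕ} {hR : 1 ≤ R} (hn : R < n.minFac) :
    (progressionSieve r M R hR).prodPrimes.Coprime n := by
  rw [prodPrimes_progressionSieve]
  refine Nat.Coprime.prod_left fun p hp => ?_
  have hpR := Nat.mem_primesLE.1 (mem_filter.1 hp).1
  refine hpR.2.coprime_iff_not_dvd.2 fun hdvd => ?_
  exact hn.not_ge ((Nat.minFac_le_of_dvd hpR.2.two_le hdvd).trans hpR.1)

theorem sum_filter_isPrimePow_div_le (r x : ℕ) {R : ℕ} (hR : 1 ≤ R) :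
    ∑ q ∈ Icc 1 x with IsPrimePow q ∧ r ∣ q - 1, (((q - 1) / r : ℕ) : ℝ) ≤
      (progressionSieve r (x / r) R hR).siftedSum + (x / r : ℕ) * (R * Nat.log 2 x) := by
  set s := progressionSieve r (x / r) R hR
  rw [← sum_filter_add_sum_filter_not _ (fun q => R < q.minFac), filter_filter, filter_filter]
  gcongr
  · rw [BoundingSieve.siftedSum, ← sum_filter]
    refine sum_le_sum_of_subset_of_nonneg (fun q hq => ?_) fun n _ _ => s.weights_nonneg n
    obtain ⟨hq, ⟨-, hdvd⟩, hmin⟩ := mem_filter.1 hq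
    exact mem_filter.2 ⟨mem_support_progressionSieve hq hdvd,
      coprime_prodPrimes_progressionSieve hmin⟩
  · calc _ ≤ ∑ q ∈ Icc 1 x with IsPrimePow q ∧ q.minFac ≤ R, ((x / r : ℕ) : ℝ) := by
          refine (sum_le_sum fun q hq => ?_).trans
            (sum_le_sum_of_subset_of_nonneg (fun q hq => ?_) fun _ _ _ => Nat.cast_nonneg _)
          · have hqx := (mem_Icc.1 (mem_filter.1 hq).1).2
            exact_mod_cast Nat.div_le_div_right (q.sub_le 1 |>.trans hqx)
          · obtain ⟨hq, ⟨hpow, -⟩, hmin⟩ := mem_filter.1 hq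
            exact mem_filter.2 ⟨hq, hpow, not_lt.1 hmin⟩
      _ ≤ (x / r : ℕ) * (R * Nat.log 2 x) := by
          rw [sum_const, nsmul_eq_mul, mul_comm]
          gcongr
          exact_mod_cast card_filter_isPrimePow_minFac_le x R

theorem sum_N_le_totient_mul_sum (t x : ℕ) :
    ∑ q ∈ Icc 1 x with IsPrimePow q, N t q ≤
      (rad4 t).totient * ∑ q ∈ Icc 1 x with IsPrimePow q ∧ rad4 t ∣ q - 1, (q - 1) / rad4 t := by
  rw [← filter_filter, mul_sum, sum_filter (rad4 t ∣ · - 1)]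
  refine sum_le_sum fun q _ => ?_
  split_ifs with h
  · exact N_le h
  · exact (N_eq_zero h).le

theorem natLog_two_le_two_mul_log {n : ℕ} (hn : n ≠ 0) : (Nat.log 2 n : ℝ) ≤ 2 * Real.log n := by
  have hpow : Nat.log 2 n * Real.log 2 ≤ Real.log n := by
    rw [← Real.log_pow]
    exact Real.log_le_log (by positivity) (by exact_mod_cast Nat.pow_log_le_self 2 hn)
  have htwo : 1 / 2 ≤ Real.log 2 := by linarith [Real.log_two_gt_d9]
  have hhalf : Nat.log 2 n * (1 / 2) ≤ Nat.log 2 n * Real.log 2 := by gcongr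
  linarith

theorem sum_N_le (t : ℕ) {R : ℕ} (hR : 1 ≤ R) {Q X : ℝ} (hQ : 1 ≤ Q) (hX : X = Q / rad4 t) :
    ∑ q ∈ Icc 1 ⌊Q⌋₊ with IsPrimePow q, (N t q : ℝ) ≤
      rad4 t * (X * (X + 1) / 2 / Real.log (R + 1) + 2 * X * R ^ 2 +
        X * (R * (2 * Real.log Q))) := by
  set r := rad4 t
  set M := ⌊Q⌋₊ / r with hM
  have hx : ⌊Q⌋₊ ≠ 0 := (Nat.floor_pos.2 hQ).ne'
  have hMX : (M : ℝ) ≤ X := by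
    rw [hM, ← Nat.floor_div_natCast, hX]
    exact Nat.floor_le (by positivity)
  have hX0 : 0 ≤ X := (Nat.cast_nonneg _).trans hMX
  have hfloor : (Nat.log 2 ⌊Q⌋₊ : ℝ) ≤ 2 * Real.log Q := by
    refine (natLog_two_le_two_mul_log hx).trans ?_
    gcongr
    exact Nat.floor_le (by positivity)
  have hlogR : 0 ≤ Real.log (R + 1) := Real.log_nonneg (by simp)
  calc ∑ q ∈ Icc 1 ⌊Q⌋₊ with IsPrimePow q, (N t q : ℝ)
      ≤ r.totient * ∑ q ∈ Icc 1 ⌊Q⌋₊ with IsPrimePow q ∧ r ∣ q - 1, (((q - 1) / r : ℕ) : ℝ) := by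
        exact_mod_cast sum_N_le_totient_mul_sum t ⌊Q⌋₊
    _ ≤ r.totient * (progressionSieve r M R hR).siftedSum +
          r.totient * (M * (R * Nat.log 2 ⌊Q⌋₊)) := by
        rw [← mul_add]
        gcongr
        exact sum_filter_isPrimePow_div_le r ⌊Q⌋₊ hR
    _ ≤ r * (M * (M + 1) / 2 / Real.log (R + 1) + 2 * M * R ^ 2) +
          r * (M * (R * Nat.log 2 ⌊Q⌋₊)) := by
        refine add_le_add (totient_mul_siftedSum_progressionSieve_le (rad4_pos t)) ?_
        gcongr
        exact Nat.totient_le r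
    _ ≤ r * (X * (X + 1) / 2 / Real.log (R + 1) + 2 * X * R ^ 2) +
          r * (X * (R * (2 * Real.log Q))) := by gcongr
    _ = _ := by ring

theorem eventually_sieve_bound_le {θ K κ : ℝ} (hθ0 : 0 < θ) (hθ : 2 * θ < 1)
    (hκ : 1 / (2 * θ) < κ) :
    ∀ᶠ X : ℝ in atTop, X * (X + 1) / 2 / (θ * Real.log X) + 2 * X * (X ^ θ) ^ 2 +
      X * (X ^ θ * (K * Real.log X)) ≤ κ * (X ^ 2 / Real.log X) := by
  have hinv : Tendsto (fun X : ℝ => X⁻¹) atTop (𝓝 0) := tendsto_inv_atTop_zero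
  have hlog : Tendsto (fun X : ℝ => Real.log X / X ^ (1 - 2 * θ)) atTop (𝓝 0) :=
    (isLittleO_log_rpow_atTop (by linarith)).tendsto_div_nhds_zero
  have hlogsq : Tendsto (fun X : ℝ => Real.log X ^ (2 : ℝ) / X ^ (1 - θ)) atTop (𝓝 0) :=
    (isLittleO_log_rpow_rpow_atTop 2 (by linarith)).tendsto_div_nhds_zero
  have hlim : Tendsto (fun X : ℝ => (1 + X⁻¹) * (1 / (2 * θ)) +
      2 * (Real.log X / X ^ (1 - 2 * θ)) + K * (Real.log X ^ (2 : ℝ) / X ^ (1 - θ)))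
      atTop (𝓝 (1 / (2 * θ))) := by
    simpa using (((hinv.const_add 1).mul_const _).add (hlog.const_mul 2)).add (hlogsq.const_mul K)
  filter_upwards [hlim.eventually_lt_const hκ, eventually_gt_atTop 1] with X hX hX1
  have hX0 : 0 < X := zero_lt_one.trans hX1
  have hlogX : 0 < Real.log X := Real.log_pos hX1
  have hXθ : 0 < X ^ θ := Real.rpow_pos_of_pos hX0 _
  have hpow₂ : X ^ (1 - 2 * θ) = X / (X ^ θ) ^ 2 := by
    rw [Real.rpow_sub hX0, Real.rpow_one, mul_comm, Real.rpow_mul hX0.le, Real.rpow_two]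
  have hpow₁ : X ^ (1 - θ) = X / X ^ θ := by rw [Real.rpow_sub hX0, Real.rpow_one]
  rw [hpow₂, hpow₁, Real.rpow_two] at hX
  refine le_trans (le_of_eq ?_)
    (mul_le_mul_of_nonneg_right hX.le (by positivity : 0 ≤ X ^ 2 / Real.log X))
  field_simp

theorem eventually_sum_N_le (C : ℝ) {δ : ℝ} (hδ : 0 < δ) :
    ∀ᶠ X : ℝ in atTop, ∀ (t : ℕ) (Q : ℝ), 1 ≤ Q → X = Q / rad4 t →
      Real.log Q ≤ C * Real.log X →
      ∑ q ∈ Icc 1 ⌊Q⌋₊ with IsPrimePow q, (N t q : ℝ) ≤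
        rad4 t * ((1 + δ) * (X ^ 2 / Real.log X)) := by
  set θ : ℝ := 1 / (2 + δ) with hθ
  have hθ0 : 0 < θ := by positivity
  have hθ1 : 2 * θ < 1 := by
    rw [hθ, mul_one_div, div_lt_one (by linarith)]
    linarith
  have hκ : 1 / (2 * θ) < 1 + δ := by
    rw [hθ]
    field_simp
    linarith
  filter_upwards [eventually_sieve_bound_le (K := 2 * C) hθ0 hθ1 hκ, eventually_gt_atTop 1]
    with X hmain hX1 t Q hQ hX hlogQ
  have hX0 : 0 < X := zero_lt_one.trans hX1
  have hXθ : 1 ≤ X ^ θ := Real.one_le_rpow hX1.le hθ0.le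
  have hlogX : 0 < Real.log X := Real.log_pos hX1
  have hlogQ₀ : 0 ≤ Real.log Q := Real.log_nonneg hQ
  set R := ⌊X ^ θ⌋₊
  have hRle : (R : ℝ) ≤ X ^ θ := Nat.floor_le (zero_le_one.trans hXθ)
  have hlogR : θ * Real.log X ≤ Real.log (R + 1) := by
    rw [← Real.log_rpow hX0]
    exact Real.log_le_log (zero_lt_one.trans_le hXθ) (Nat.lt_floor_add_one _).le
  calc ∑ q ∈ Icc 1 ⌊Q⌋₊ with IsPrimePow q, (N t q : ℝ)
      ≤ rad4 t * (X * (X + 1) / 2 / Real.log (R + 1) + 2 * X * R ^ 2 +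
          X * (R * (2 * Real.log Q))) := sum_N_le t (Nat.floor_pos.2 hXθ) hQ hX
    _ ≤ rad4 t * (X * (X + 1) / 2 / (θ * Real.log X) + 2 * X * (X ^ θ) ^ 2 +
          X * (X ^ θ * (2 * (C * Real.log X)))) := by gcongr
    _ ≤ rad4 t * ((1 + δ) * (X ^ 2 / Real.log X)) := by
        rw [← mul_assoc 2]
        gcongr

theorem rpow_le_div_of_le_rpow_one_sub {Q ε r : ℝ} (hQ : 0 < Q) (hr : 0 < r)
    (h : r ≤ Q ^ (1 - ε)) : Q ^ ε ≤ Q / r := by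
  rw [le_div_iff₀ hr]
  calc Q ^ ε * r ≤ Q ^ ε * Q ^ (1 - ε) := by gcongr
    _ = Q := by rw [← Real.rpow_add hQ, add_sub_cancel, Real.rpow_one]

theorem log_le_inv_mul_log_of_rpow_le {Q ε X : ℝ} (hQ : 0 < Q) (hε : 0 < ε) (h : Q ^ ε ≤ X) :
    Real.log Q ≤ ε⁻¹ * Real.log X := by
  rw [le_inv_mul_iff₀ hε, ← Real.log_rpow hQ]
  exact Real.log_le_log (Real.rpow_pos_of_pos hQ ε) h

theorem tlog_eq_log {x : ℝ} (hx : Real.exp 2 ≤ x) : tlog x = Real.log x :=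
  max_eq_left ((Real.le_log_iff_exp_le ((Real.exp_pos 2).trans_le hx)).2 hx)

end PrimePowers

end IrredBinomials

open Classical in
theorem theorem1 (ε : ℝ) (hε : 0 < ε) (δ : ℝ) (hδ : 0 < δ) :
    ∃ Q₀ : ℝ, ∀ Q : ℝ, Q₀ ≤ Q → ∀ t : ℕ, 0 < t →
      (IrredBinomials.rad4 t : ℝ) ≤ Q ^ (1 - ε) →
      (∑ q ∈ (Finset.Icc 1 ⌊Q⌋₊).filter IsPrimePow, (IrredBinomials.N t q : ℝ)) ≤
        (1 + δ) * (Q ^ 2 /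
          ((IrredBinomials.rad4 t : ℝ) *
            IrredBinomials.tlog (Q / (IrredBinomials.rad4 t : ℝ)))) := by
  obtain ⟨X₀, hX₀⟩ := Filter.eventually_atTop.1 (IrredBinomials.eventually_sum_N_le ε⁻¹ hδ)
  obtain ⟨Q₁, hQ₁⟩ := Filter.eventually_atTop.1
    ((tendsto_rpow_atTop hε).eventually_ge_atTop (max X₀ (Real.exp 2)))
  refine ⟨max Q₁ 1, fun Q hQ t _ hrad => ?_⟩
  obtain ⟨hQ₁Q, hQ1⟩ := max_le_iff.1 hQ
  have hQ0 : 0 < Q := zero_lt_one.trans_le hQ1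
  have hr : (0 : ℝ) < IrredBinomials.rad4 t := by exact_mod_cast IrredBinomials.rad4_pos t
  set X := Q / IrredBinomials.rad4 t with hX
  have hεX : Q ^ ε ≤ X := IrredBinomials.rpow_le_div_of_le_rpow_one_sub hQ0 hr hrad
  obtain ⟨hX₀X, hexp⟩ := max_le_iff.1 ((hQ₁ Q hQ₁Q).trans hεX)
  calc _ ≤ IrredBinomials.rad4 t * ((1 + δ) * (X ^ 2 / Real.log X)) := by
        convert hX₀ X hX₀X t Q hQ1 hX (IrredBinomials.log_le_inv_mul_log_of_rpow_le hQ0 hε hεX)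
    _ = _ := by
        rw [IrredBinomials.tlog_eq_log hexp, hX]
        field_simp
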